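/- A partial function on $n$ bits is a map $f:\{0,1\}^n\times\{0,1\}^n\to\{0,1,?\}$, where $?$ means that $f$ is undefined at that input; $f$ is permutation-invariant if $f(x^\pi,y^\pi)=f(x,y)$ for all $x,y\in\{0,1\}^n$ and every permutation $\pi$ of the $n$ coordinates, where $(x^\pi)_i=x_{\pi(i)}$. A two-party randomized protocol (with public and private randomness) computes $f$ if it outputs $f(x,y)$ with probability at least $2/3$ on every input $(x,y)$ with $f(x,y)\neq{?}$. Let $R(f)$ be the minimum, over all protocols $\Pi$ computing $f$, of the worst-case number of bits exchanged by $\Pi$, and let $$\mathrm{IC}(f)=\inf_{\Pi}\ \sup_{\mu}\ \bigl(I(X;\Pi\mid Y)+I(Y;\Pi\mid X)\bigr),$$ where $\Pi$ ranges over the protocols computing $f$, $\mu$ ranges over all distributions of $(X,Y)$ on $\{0,1\}^n\times\{0,1\}^n$, and inside the conditional mutual information (in bits) $\Pi$ denotes the transcript (the public coins together with all exchanged bits). Let $G:\mathbb R\to\mathbb R$ be a function and let $p$ be a real polynomial such that $$R(f)\le p(\mathrm{IC}(f))+G(\log_2 n)$$ for every $n\ge 1$ and every permutation-invariant partial function $f$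 on $n$ bits. Then $$R(g)\le p(\mathrm{IC}(g))+G(n)$$ for every $n$ and every partial function $g$ on $n$ bits. (In particular, if a bound $R(f)\le\mathrm{poly}(\mathrm{IC}(f))+G(\log_2 n)$ holds for permutation-invariant partial functions, then $R(g)\le\mathrm{poly}(\mathrm{IC}(g))+G(n)$ for all partial functions, even with the same polynomial.) -/

import Mathlib

/-! ### Entropy and conditional mutual information (in bits) -/

/-- Shannon entropy, in bits, of a discrete distribution. It is only used for distributions of
finite support, for which the sum has finitely many nonzero terms. -/
noncomputable def shannonEntropy {A : Type} (p : PMF A) : ℝ :=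
  (∑' a, Real.negMulLog (p a).toReal) / Real.log 2

/-- The conditional entropy `H(A | B) = H(A, B) - H(B)` for a joint law `p` of `(A, B)`. -/
noncomputable def condEntropy {A B : Type} (p : PMF (A × B)) : ℝ :=
  shannonEntropy p - shannonEntropy (p.map Prod.snd)

/-- The conditional mutual information `I(A ; B | C) = H(A | C) - H(A | B, C)` for a joint
law `p` of `(A, B, C)`. -/
noncomputable def condMutualInfo {A B C : Type} (p : PMF (A × B × C)) : ℝ :=
  condEntropy (p.map fun t => (t.1, t.2.2)) - condEntropy p

/-! ### Two-party communication protocols -/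

/-- A two-party protocol tree with private randomness, for inputs in `X` (Alice) and `Y` (Bob).
An internal node is owned by one of the players, who sends one bit, drawn from a distribution
depending on that player's own input (and on the node, i.e. on the bits exchanged so far).
A leaf carries the output. -/
inductive PrivateCoinProtocol (X Y : Type) : Type
  | leaf (out : Bool) : PrivateCoinProtocol X Y
  | alice (msg : X → PMF Bool) (next : Bool → PrivateCoinProtocol X Y) : PrivateCoinProtocol X Y
  | bob (msg : Y → PMF Bool) (next : Bool → PrivateCoinProtocol X Y) : PrivateCoinProtocol X Y

namespace PrivateCoinProtocol

/-- The maximal number of bits exchanged. -/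
def depth {X Y : Type} : PrivateCoinProtocol X Y → ℕ
  | leaf _ => 0
  | alice _ next => 1 + max (depth (next false)) (depth (next true))
  | bob _ next => 1 + max (depth (next false)) (depth (next true))

/-- The joint law of the sequence of exchanged bits and of the output on input `(x, y)`. -/
noncomputable def run {X Y : Type} :
    PrivateCoinProtocol X Y → X → Y → PMF (List Bool × Bool)
  | leaf out, _, _ => PMF.pure ([], out)
  | alice msg next, x, y =>
      (msg x).bind fun b => (run (next b) x y).map fun t => (b :: t.1, t.2)
  | bob msg next, x, y =>
      (msg y).bind fun b => (run (next b) x y).map fun t => (b :: t.1, t.2)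

end PrivateCoinProtocol

/-- A randomized protocol with public and private randomness: the public coins are an element
of a finite set, drawn from an arbitrary distribution and seen by both players, who then run
the corresponding private-coin protocol. -/
structure RandomizedProtocol (X Y : Type) : Type where
  numSeeds : ℕ
  coins : PMF (Fin numSeeds)
  tree : Fin numSeeds → PrivateCoinProtocol X Y

namespace RandomizedProtocol

/-- The communication cost: the number of exchanged bits in the worst case. -/
def cost {X Y : Type} (P : RandomizedProtocol X Y) : ℕ :=
  Finset.univ.sup fun r => (P.tree r).depth

/-- The law of the output on input `(x, y)`. -/
noncomputable def output {X Y : Type} (P : RandomizedProtocol X Y) (x : X) (y : Y) : PMF Bool :=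
  P.coins.bind fun r => ((P.tree r).run x y).map Prod.snd

/-- The law of the transcript on input `(x, y)`: the public coins together with all the bits
exchanged. -/
noncomputable def transcript {X Y : Type} (P : RandomizedProtocol X Y) (x : X) (y : Y) :
    PMF (Fin P.numSeeds × List Bool) :=
  P.coins.bind fun r => ((P.tree r).run x y).map fun t => (r, t.1)

/-- The joint law of `(X, Y, Π)` when the inputs `(X, Y)` have law `μ` and `Π` is the
transcript. -/
noncomputable def jointLaw {X Y : Type} (P : RandomizedProtocol X Y) (μ : PMF (X × Y)) :
    PMF (X × Y × (Fin P.numSeeds × List Bool)) :=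
  μ.bind fun z => (P.transcript z.1 z.2).map fun t => (z.1, z.2, t)

/-- The internal information cost `I(X ; Π | Y) + I(Y ; Π | X)` under the input law `μ`. -/
noncomputable def infoCost {X Y : Type} (P : RandomizedProtocol X Y) (μ : PMF (X × Y)) : ℝ :=
  condMutualInfo ((P.jointLaw μ).map fun t => (t.1, t.2.2, t.2.1)) +
    condMutualInfo ((P.jointLaw μ).map fun t => (t.2.1, t.2.2, t.1))

end RandomizedProtocol

/-! ### Partial functions on pairs of bit strings and their complexities -/

/-- Partial functions `{0,1}^n × {0,1}^n → {0,1,?}`; the value `?` is `none`. -/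
abbrev PartialBoolFun (n : ℕ) : Type := (Fin n → Bool) → (Fin n → Bool) → Option Bool

namespace PartialBoolFun

/-- `f(x^π, y^π) = f(x, y)` for all permutations `π` of the coordinates. -/
def PermInvariant {n : ℕ} (f : PartialBoolFun n) : Prop :=
  ∀ (π : Equiv.Perm (Fin n)) (x y : Fin n → Bool), f (x ∘ π) (y ∘ π) = f x y

/-- The protocol `P` outputs `f(x, y)` with probability at least `2/3` on every input `(x, y)`
on which `f` is defined. -/
def ComputedBy {n : ℕ} (f : PartialBoolFun n)
    (P : RandomizedProtocol (Fin n → Bool) (Fin n → Bool)) : Prop :=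
  ∀ (x y : Fin n → Bool) (b : Bool), f x y = some b → 2 / 3 ≤ (P.output x y b).toReal

/-- The randomized communication complexity `R(f)`. -/
noncomputable def R {n : ℕ} (f : PartialBoolFun n) : ℕ :=
  sInf {c : ℕ | ∃ P, f.ComputedBy P ∧ P.cost = c}

/-- The prior-free information complexity `IC(f)`: the infimum over the protocols computing `f`
of the supremum over all input distributions of the information cost. The infimum and the
supremum are formed in the extended reals; the value is finite. -/
noncomputable def IC {n : ℕ} (f : PartialBoolFun n) : ℝ :=
  (⨅ (P : RandomizedProtocol (Fin n → Bool) (Fin n → Bool)) (_ : f.ComputedBy P),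
    ⨆ μ : PMF ((Fin n → Bool) × (Fin n → Bool)), (P.infoCost μ : EReal)).toReal

end PartialBoolFun

/-! A permutation-invariant function may depend on the Hamming weight, and weights of strings of
length `2 ^ n` take enough values to name every string of length `n`. So `g` is turned into
`onWeights g` on `2 ^ n` bits, which decodes the weights and applies `g`; the logarithm of the new
length is `n`.

The two functions have equal `R` and `IC`, because each reduces to the other by maps that the
players apply locally: decoding one way, a section of it the other way. Pulling a protocol back
along such maps keeps its cost and outputs. Its information cost under `μ` is at most that of the
original under the pushed-forward law (`infoCost_comap_le`): the transcript sees the inputs only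
through the maps, and conditioning on less leaves more entropy. -/

/-! ### Entropy of finitely supported laws -/

/-- The log-sum inequality. -/
theorem sum_mul_log_sub_le {ι : Type*} (s : Finset ι) (q r : ι → ℝ) (hq : ∀ i ∈ s, 0 ≤ q i)
    (hqr : ∀ i ∈ s, q i ≤ r i) :
    ∑ i ∈ s, (q i * Real.log (r i) - q i * Real.log (q i)) ≤
      (∑ i ∈ s, q i) * Real.log (∑ i ∈ s, r i) -
        (∑ i ∈ s, q i) * Real.log (∑ i ∈ s, q i) := by
  set Q := ∑ i ∈ s, q i with hQ
  set T := ∑ i ∈ s, r i with hT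
  have hr : ∀ i ∈ s, 0 ≤ r i := fun i hi => (hq i hi).trans (hqr i hi)
  rcases (Finset.sum_nonneg hq).eq_or_lt with h0 | hQpos
  · have hz := (Finset.sum_eq_zero_iff_of_nonneg hq).1 h0.symm
    have hQ0 : Q = 0 := h0.symm
    rw [hQ0, Finset.sum_eq_zero fun i hi => by rw [hz i hi]; ring]
    simp
  · have hTpos : 0 < T := hQpos.trans_le (Finset.sum_le_sum hqr)
    -- This is `log u ≤ u - 1` at `u = (Q / T) * r i / q i`; the corrections `Q / T * r i - q i` sum
    -- to zero. The bound `q i ≤ r i` excludes the default value `log 0 = 0` at `r i` when `q i >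
    -- 0`.
    have key : ∀ i ∈ s, q i * Real.log (r i) - q i * Real.log (q i) ≤
        q i * (Real.log T - Real.log Q) + (Q / T * r i - q i) := by
      intro i hi
      rcases (hq i hi).eq_or_lt with h | h
      · rw [← h]
        have := mul_nonneg (div_pos hQpos hTpos).le (hr i hi)
        simpa using this
      · have hri : 0 < r i := h.trans_le (hqr i hi)
        have hlog := Real.log_le_sub_one_of_pos (show 0 < Q / T * r i / q i by positivity)
        rw [Real.log_div (by positivity) h.ne', Real.log_mul (by positivity) hri.ne',
          Real.log_div hQpos.ne' hTpos.ne'] at hlog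
        have := mul_le_mul_of_nonneg_left hlog h.le
        have hc : q i * (Q / T * r i / q i - 1) = Q / T * r i - q i := by field_simp
        rw [hc] at this
        linarith
    refine (Finset.sum_le_sum key).trans_eq ?_
    rw [Finset.sum_add_distrib, Finset.sum_sub_distrib, ← Finset.sum_mul, ← Finset.mul_sum,
      ← hQ, ← hT, div_mul_cancel₀ _ hTpos.ne']
    ring

namespace PMF

theorem sum_toReal_eq_one {A : Type*} (p : PMF A) (T : Finset A) (hT : ∀ a ∉ T, p a = 0) :
    ∑ a ∈ T, (p a).toReal = 1 := by
  rw [← ENNReal.toReal_sum fun a _ => p.apply_ne_top a, ← tsum_eq_sum (L := .unconditional A) hT,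
    p.tsum_coe,
    ENNReal.toReal_one]

open Classical in
theorem toReal_map_apply {A B : Type*} (p : PMF A) (f : A → B) (T : Finset A)
    (hT : ∀ a ∉ T, p a = 0) (b : B) :
    (p.map f b).toReal = ∑ a ∈ T with f a = b, (p a).toReal := by
  rw [PMF.map_apply, tsum_eq_sum (s := T) fun a ha => by simp [hT a ha],
    ENNReal.toReal_sum fun a _ => by split_ifs <;> simp [p.apply_ne_top], Finset.sum_filter]
  refine Finset.sum_congr rfl fun a _ => ?_
  by_cases h : f a = b
  · simp [h]
  · simp [h, Ne.symm h]

theorem map_apply_eq_zero {A B : Type*} (p : PMF A) (f : A → B) (b : B)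
    (h : ∀ a, f a = b → p a = 0) : p.map f b = 0 := by
  rw [PMF.map_apply]
  refine ENNReal.tsum_eq_zero.2 fun a => ?_
  split_ifs with hb
  · exact h a hb.symm
  · rfl

theorem toReal_map_snd_apply {B C : Type*} [Fintype C] (q : PMF (B × C)) (S : Finset B)
    (hS : ∀ b ∉ S, ∀ c, q (b, c) = 0) (c : C) :
    (q.map Prod.snd c).toReal = ∑ b ∈ S, (q (b, c)).toReal := by
  classical
  rw [q.toReal_map_apply Prod.snd (S ×ˢ Finset.univ) (fun a ha => hS a.1 (by simpa using ha) a.2),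
    Finset.sum_filter, Finset.sum_product]
  simp

theorem toReal_map_prodMap_id_apply {B C D : Type*} [Fintype C] [DecidableEq D]
    (q : PMF (B × C)) (S : Finset B)
    (hS : ∀ b ∉ S, ∀ c, q (b, c) = 0) (ψ : C → D) (b : B) (d : D) :
    (q.map (Prod.map id ψ) (b, d)).toReal = ∑ c with ψ c = d, (q (b, c)).toReal := by
  classical
  rw [q.toReal_map_apply _ (S ×ˢ Finset.univ) (fun a ha => hS a.1 (by simpa using ha) a.2),
    Finset.sum_filter, Finset.sum_product, Finset.sum_filter]
  simp only [Prod.map_apply, id_eq, Prod.mk.injEq, ite_and]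
  by_cases hb : b ∈ S
  · rw [Finset.sum_eq_single_of_mem b hb fun b' _ h => by simp [h]]
    simp
  · rw [Finset.sum_eq_zero, eq_comm, Finset.sum_eq_zero]
    · intro c _
      simp [hS b hb c]
    · intro b' hb'
      have : b' ≠ b := fun h => hb (h ▸ hb')
      simp [this]

end PMF

theorem shannonEntropy_eq_sum {A : Type} (p : PMF A) (T : Finset A) (hT : ∀ a ∉ T, p a = 0) :
    shannonEntropy p = (∑ a ∈ T, Real.negMulLog (p a).toReal) / Real.log 2 := by
  rw [shannonEntropy, tsum_eq_sum fun a ha => by simp [hT a ha]]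

theorem condEntropy_eq_sum {B C : Type} [Fintype C] (q : PMF (B × C)) (S : Finset B)
    (hS : ∀ b ∉ S, ∀ c, q (b, c) = 0) :
    condEntropy q = (∑ b ∈ S, ∑ c, ((q (b, c)).toReal * Real.log (q.map Prod.snd c).toReal -
      (q (b, c)).toReal * Real.log (q (b, c)).toReal)) / Real.log 2 := by
  rw [condEntropy, shannonEntropy_eq_sum q (S ×ˢ Finset.univ)
      (fun a ha => hS a.1 (by simpa using ha) a.2),
    shannonEntropy_eq_sum (q.map Prod.snd) Finset.univ (by simp), ← sub_div, Finset.sum_product,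
    Finset.sum_comm (s := S), Finset.sum_comm (s := S), ← Finset.sum_sub_distrib]
  congr 1
  refine Finset.sum_congr rfl fun c _ => ?_
  rw [Finset.sum_sub_distrib, ← Finset.sum_mul, ← q.toReal_map_snd_apply S hS c]
  simp only [Real.negMulLog, neg_mul, Finset.sum_neg_distrib]
  ring

/-- Conditioning on a function of a random variable gives a larger entropy. -/
theorem condEntropy_le_condEntropy_map {B C D : Type} [Fintype C] [Fintype D] (q : PMF (B × C))
    (S : Finset B) (hS : ∀ b ∉ S, ∀ c, q (b, c) = 0) (ψ : C → D) :
    condEntropy q ≤ condEntropy (q.map (Prod.map id ψ)) := by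
  classical
  have hS' : ∀ b ∉ S, ∀ d, q.map (Prod.map id ψ) (b, d) = 0 := fun b hb d =>
    PMF.map_apply_eq_zero _ _ _ fun a ha => by
      obtain ⟨rfl, -⟩ := Prod.mk.inj ha
      exact hS _ hb _
  have hsnd : ∀ d, ((q.map (Prod.map id ψ)).map Prod.snd d).toReal =
      ∑ c with ψ c = d, (q.map Prod.snd c).toReal := fun d => by
    rw [PMF.toReal_map_snd_apply _ S hS']
    simp only [q.toReal_map_prodMap_id_apply S hS, q.toReal_map_snd_apply S hS]
    exact Finset.sum_comm
  rw [condEntropy_eq_sum q S hS, condEntropy_eq_sum _ S hS']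
  refine div_le_div_of_nonneg_right (Finset.sum_le_sum fun b hb => ?_)
    (Real.log_nonneg one_le_two)
  rw [← Finset.sum_fiberwise (s := Finset.univ) (g := ψ)]
  refine Finset.sum_le_sum fun d _ => ?_
  rw [hsnd, q.toReal_map_prodMap_id_apply S hS]
  -- Log-sum inequality over one fibre of `ψ`, with `b` fixed: joint masses against marginal masses.
  refine sum_mul_log_sub_le _ _ _ (fun _ _ => ENNReal.toReal_nonneg) fun c _ => ?_
  rw [q.toReal_map_snd_apply S hS]
  exact Finset.single_le_sum (f := fun b => (q (b, c)).toReal)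
    (fun _ _ => ENNReal.toReal_nonneg) hb

/-! ### Laws generated by a channel -/

/-- The law of `(A, B, C)` when `(A, C)` has law `μ` and `B` is drawn from `W A C`. -/
noncomputable def channelLaw {A B C : Type} (μ : PMF (A × C)) (W : A → C → PMF B) :
    PMF (A × B × C) :=
  μ.bind fun z => (W z.1 z.2).map fun b => (z.1, b, z.2)

theorem channelLaw_apply {A B C : Type} (μ : PMF (A × C)) (W : A → C → PMF B) (a : A) (b : B)
    (c : C) : channelLaw μ W (a, b, c) = μ (a, c) * W a c b := by
  classical
  rw [channelLaw, PMF.bind_apply, tsum_eq_single (a, c), PMF.map_apply, tsum_eq_single b]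
  · simp
  · intro b' hb'
    simp [Ne.symm hb']
  · rintro ⟨a', c'⟩ h
    rw [PMF.map_apply_eq_zero, mul_zero]
    rintro b' hb'
    simp only [Prod.mk.injEq] at hb'
    exact absurd (Prod.ext hb'.1 hb'.2.2) h

theorem channelLaw_map_inputs {A B C : Type} (μ : PMF (A × C)) (W : A → C → PMF B) :
    (channelLaw μ W).map (fun t => (t.1, t.2.2)) = μ := by
  rw [channelLaw, PMF.map_bind]
  simp only [PMF.map_comp, Function.comp_def, Prod.mk.eta]
  exact (congrArg μ.bind (funext fun z => PMF.map_const _ z)).trans μ.bind_pure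

theorem channelLaw_map {A B C A' C' : Type} (μ : PMF (A' × C')) (W : A → C → PMF B)
    (φ : A' → A) (ψ : C' → C) :
    (channelLaw μ fun a c => W (φ a) (ψ c)).map (Prod.map φ (Prod.map id ψ)) =
      channelLaw (μ.map (Prod.map φ ψ)) W := by
  rw [channelLaw, channelLaw, PMF.map_bind, PMF.bind_map]
  simp only [PMF.map_comp, Function.comp_def, Prod.map_apply, id_eq, Prod.map_fst, Prod.map_snd]

/-- Chain rule: the second term is the entropy of the output given both inputs. -/
theorem shannonEntropy_channelLaw {A B C : Type} [Fintype A] [Fintype C] (μ : PMF (A × C))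
    (W : A → C → PMF B) (S : Finset B) (hS : ∀ a c, ∀ b ∉ S, W a c b = 0) :
    shannonEntropy (channelLaw μ W) = shannonEntropy μ +
      ∑ z : A × C, (μ z).toReal * shannonEntropy (W z.1 z.2) := by
  rw [shannonEntropy_eq_sum (channelLaw μ W) (Finset.univ ×ˢ S ×ˢ Finset.univ),
    shannonEntropy_eq_sum μ Finset.univ (by simp)]
  · simp only [fun a c => shannonEntropy_eq_sum (W a c) S (hS a c), Finset.sum_product,
      channelLaw_apply, ENNReal.toReal_mul, Real.negMulLog_mul, ← mul_div_assoc,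
      ← Finset.sum_div, ← add_div, Fintype.sum_prod_type, ← Finset.sum_add_distrib]
    congr 1
    refine Finset.sum_congr rfl fun a _ => ?_
    rw [Finset.sum_comm]
    refine Finset.sum_congr rfl fun c _ => ?_
    rw [Finset.sum_add_distrib, ← Finset.sum_mul, ← Finset.mul_sum,
      (W a c).sum_toReal_eq_one S (hS a c), one_mul]
  · rintro ⟨a, b, c⟩ h
    rw [channelLaw_apply, hS a c b (by simpa using h), mul_zero]

/-- Symmetry of mutual information, `I(A ; B | C) = H(B | C) - H(B | A, C)`. In this form the last
term depends only on the inputs that the channel actually reads. -/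
theorem condMutualInfo_channelLaw {A B C : Type} [Fintype A] [Fintype C] (μ : PMF (A × C))
    (W : A → C → PMF B) (S : Finset B) (hS : ∀ a c, ∀ b ∉ S, W a c b = 0) :
    condMutualInfo (channelLaw μ W) = condEntropy ((channelLaw μ W).map Prod.snd) -
      ∑ z : A × C, (μ z).toReal * shannonEntropy (W z.1 z.2) := by
  have hC : ((channelLaw μ W).map Prod.snd).map Prod.snd = μ.map Prod.snd := by
    conv_rhs => rw [← channelLaw_map_inputs μ W]
    rw [PMF.map_comp, PMF.map_comp]
    rfl
  rw [condMutualInfo, channelLaw_map_inputs, condEntropy, condEntropy, condEntropy, hC,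
    shannonEntropy_channelLaw μ W S hS]
  ring

theorem sum_toReal_map_mul {A B : Type*} [Fintype A] [Fintype B] (p : PMF A) (f : A → B)
    (F : B → ℝ) : ∑ b, (p.map f b).toReal * F b = ∑ a, (p a).toReal * F (f a) := by
  classical
  rw [← Finset.sum_fiberwise (s := Finset.univ) (g := f)]
  refine Finset.sum_congr rfl fun b _ => ?_
  rw [p.toReal_map_apply f Finset.univ (by simp), Finset.sum_mul]
  refine Finset.sum_congr (by congr) fun a ha => ?_
  rw [(Finset.mem_filter.1 ha).2]

/-- If the channel reads its inputs through `φ` and `ψ`, then passing to the law of the values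
of `φ` and `ψ` does not decrease the conditional mutual information. -/
theorem condMutualInfo_channelLaw_comp_le {A B C A' C' : Type} [Fintype A] [Fintype C]
    [Fintype A'] [Fintype C'] (μ : PMF (A' × C')) (W : A → C → PMF B) (S : Finset B)
    (hS : ∀ a c, ∀ b ∉ S, W a c b = 0) (φ : A' → A) (ψ : C' → C) :
    condMutualInfo (channelLaw μ fun a c => W (φ a) (ψ c)) ≤
      condMutualInfo (channelLaw (μ.map (Prod.map φ ψ)) W) := by
  rw [condMutualInfo_channelLaw _ _ S hS,
    condMutualInfo_channelLaw _ _ S fun a c => hS (φ a) (ψ c),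
    sum_toReal_map_mul μ (Prod.map φ ψ) fun z => shannonEntropy (W z.1 z.2)]
  -- The mean channel entropies now agree; what remains is that `B` has more entropy given `ψ C`
  -- than given `C`.
  refine sub_le_sub_right ?_ _
  rw [← channelLaw_map, PMF.map_comp]
  have h : Prod.snd ∘ Prod.map φ (Prod.map id ψ) =
      (Prod.map id ψ : B × C' → B × C) ∘ Prod.snd := rfl
  rw [h, ← PMF.map_comp]
  refine condEntropy_le_condEntropy_map _ S (fun b hb c => ?_) ψ
  refine PMF.map_apply_eq_zero _ _ _ ?_
  rintro ⟨a, b', c'⟩ ht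
  obtain ⟨rfl, rfl⟩ := Prod.mk.inj ht
  rw [channelLaw_apply, hS _ _ _ hb, mul_zero]

/-! ### Pulling back protocols along maps of the inputs -/

namespace PrivateCoinProtocol

variable {X Y X' Y' : Type}

/-- The protocol in which the players first apply `φ` and `ψ` to their inputs. -/
noncomputable def comap (φ : X' → X) (ψ : Y' → Y) :
    PrivateCoinProtocol X Y → PrivateCoinProtocol X' Y'
  | leaf out => leaf out
  | alice msg next => alice (fun x => msg (φ x)) fun b => comap φ ψ (next b)
  | bob msg next => bob (fun y => msg (ψ y)) fun b => comap φ ψ (next b)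

theorem depth_comap (φ : X' → X) (ψ : Y' → Y) (P : PrivateCoinProtocol X Y) :
    (P.comap φ ψ).depth = P.depth := by
  induction P with
  | leaf out => rfl
  | alice msg next ih => simp only [comap, depth, ih]
  | bob msg next ih => simp only [comap, depth, ih]

theorem run_comap (φ : X' → X) (ψ : Y' → Y) (P : PrivateCoinProtocol X Y) (x : X') (y : Y') :
    (P.comap φ ψ).run x y = P.run (φ x) (ψ y) := by
  induction P with
  | leaf out => rfl
  | alice msg next ih => simp only [comap, run, ih]
  | bob msg next ih => simp only [comap, run, ih]

theorem length_le_depth_of_mem_support_run (P : PrivateCoinProtocol X Y) (x : X) (y : Y) :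
    ∀ t ∈ (P.run x y).support, t.1.length ≤ P.depth := by
  induction P with
  | leaf out =>
    intro t ht
    obtain rfl : t = ([], out) := by simpa [run] using ht
    simp
  | alice msg next ih | bob msg next ih =>
    intro t ht
    simp only [run, PMF.mem_support_bind_iff, PMF.support_map, Set.mem_image] at ht
    obtain ⟨b, -, u, hu, rfl⟩ := ht
    have := ih b u hu
    cases b <;> simp only [depth, List.length_cons] <;> omega

end PrivateCoinProtocol

namespace RandomizedProtocol

variable {X Y X' Y' : Type}

/-- The protocol in which the players first apply `φ` and `ψ` to their inputs. -/
noncomputable def comap (φ : X' → X) (ψ : Y' → Y) (P : RandomizedProtocol X Y) :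
    RandomizedProtocol X' Y' where
  numSeeds := P.numSeeds
  coins := P.coins
  tree r := (P.tree r).comap φ ψ

theorem cost_comap (φ : X' → X) (ψ : Y' → Y) (P : RandomizedProtocol X Y) :
    (P.comap φ ψ).cost = P.cost := by
  simp only [cost, comap, PrivateCoinProtocol.depth_comap]
  rfl

theorem output_comap (φ : X' → X) (ψ : Y' → Y) (P : RandomizedProtocol X Y) (x : X') (y : Y') :
    (P.comap φ ψ).output x y = P.output (φ x) (ψ y) := by
  simp only [output, comap, PrivateCoinProtocol.run_comap]

theorem transcript_comap (φ : X' → X) (ψ : Y' → Y) (P : RandomizedProtocol X Y) (x : X')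
    (y : Y') : (P.comap φ ψ).transcript x y = P.transcript (φ x) (ψ y) := by
  simp only [transcript, comap, PrivateCoinProtocol.run_comap]

/-- Transcripts live in an infinite type, but their length is bounded by the cost, so one finite set
serves all inputs. -/
theorem exists_finset_transcript (P : RandomizedProtocol X Y) :
    ∃ S : Finset (Fin P.numSeeds × List Bool), ∀ x y, ∀ t ∉ S, P.transcript x y t = 0 := by
  have hfin : {l : List Bool | l.length ≤ P.cost}.Finite := List.finite_length_le Bool P.cost
  refine ⟨Finset.univ ×ˢ hfin.toFinset, fun x y t ht => ?_⟩
  by_contra h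
  refine ht ?_
  have h' : t ∈ (P.transcript x y).support := h
  simp only [transcript, PMF.mem_support_bind_iff, PMF.support_map, Set.mem_image] at h'
  obtain ⟨r, -, u, hu, rfl⟩ := h'
  have h1 := (P.tree r).length_le_depth_of_mem_support_run x y u hu
  have h2 : (P.tree r).depth ≤ P.cost :=
    Finset.le_sup (f := fun r => (P.tree r).depth) (Finset.mem_univ r)
  simpa using h1.trans h2

theorem jointLaw_map_alice (P : RandomizedProtocol X Y) (μ : PMF (X × Y)) :
    (P.jointLaw μ).map (fun t => (t.1, t.2.2, t.2.1)) = channelLaw μ P.transcript := by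
  rw [jointLaw, channelLaw, PMF.map_bind]
  simp only [PMF.map_comp, Function.comp_def]

theorem jointLaw_map_bob (P : RandomizedProtocol X Y) (μ : PMF (X × Y)) :
    (P.jointLaw μ).map (fun t => (t.2.1, t.2.2, t.1)) =
      channelLaw (μ.map Prod.swap) fun y x => P.transcript x y := by
  rw [jointLaw, channelLaw, PMF.map_bind, PMF.bind_map]
  simp only [PMF.map_comp, Function.comp_def, Prod.fst_swap, Prod.snd_swap]

theorem infoCost_comap_le [Fintype X] [Fintype Y] [Fintype X'] [Fintype Y'] (φ : X' → X)
    (ψ : Y' → Y) (P : RandomizedProtocol X Y) (μ : PMF (X' × Y')) :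
    (P.comap φ ψ).infoCost μ ≤ P.infoCost (μ.map (Prod.map φ ψ)) := by
  obtain ⟨S, hS⟩ := P.exists_finset_transcript
  have hW : (P.comap φ ψ).transcript = fun x y => P.transcript (φ x) (ψ y) :=
    funext₂ fun x y => P.transcript_comap φ ψ x y
  have hswap : (μ.map (Prod.map φ ψ)).map Prod.swap =
      (μ.map Prod.swap).map (Prod.map ψ φ) := by
    rw [PMF.map_comp, PMF.map_comp]
    rfl
  rw [infoCost, infoCost, jointLaw_map_alice, jointLaw_map_bob, jointLaw_map_alice,
    jointLaw_map_bob, hW, hswap]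
  exact add_le_add (condMutualInfo_channelLaw_comp_le μ P.transcript S hS φ ψ)
    (condMutualInfo_channelLaw_comp_le _ (fun y x => P.transcript x y) S
      (fun y x => hS x y) ψ φ)

end RandomizedProtocol

/-! ### Reductions between partial functions -/

namespace PartialBoolFun

variable {m n : ℕ}

/-- `φ` and `ψ` reduce `f` to `g`. -/
def ReducesVia (f : PartialBoolFun m) (g : PartialBoolFun n)
    (φ ψ : (Fin m → Bool) → (Fin n → Bool)) : Prop :=
  ∀ x y b, f x y = some b → g (φ x) (ψ y) = some b

variable {f : PartialBoolFun m} {g : PartialBoolFun n}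
  {φ ψ : (Fin m → Bool) → (Fin n → Bool)} {φ' ψ' : (Fin n → Bool) → (Fin m → Bool)}

theorem ComputedBy.comap (h : f.ReducesVia g φ ψ)
    {P : RandomizedProtocol (Fin n → Bool) (Fin n → Bool)} (hP : g.ComputedBy P) :
    f.ComputedBy (P.comap φ ψ) := fun x y b hb => by
  rw [P.output_comap]
  exact hP _ _ b (h x y b hb)

theorem R_eq_of_reducesVia (h : f.ReducesVia g φ ψ) (h' : g.ReducesVia f φ' ψ') :
    f.R = g.R := by
  unfold R
  congr 1
  ext c
  constructor
  · rintro ⟨P, hP, rfl⟩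
    exact ⟨P.comap φ' ψ', hP.comap h', P.cost_comap φ' ψ'⟩
  · rintro ⟨P, hP, rfl⟩
    exact ⟨P.comap φ ψ, hP.comap h, P.cost_comap φ ψ⟩

/-- Stated before `EReal.toReal` is applied, since that map sends infinities to `0` and is not
monotone; only the equality from both directions passes through it. -/
theorem iInf_iSup_infoCost_le (h : f.ReducesVia g φ ψ) :
    (⨅ (P : RandomizedProtocol (Fin m → Bool) (Fin m → Bool)) (_ : f.ComputedBy P),
      ⨆ μ : PMF ((Fin m → Bool) × (Fin m → Bool)), (P.infoCost μ : EReal)) ≤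
    ⨅ (P : RandomizedProtocol (Fin n → Bool) (Fin n → Bool)) (_ : g.ComputedBy P),
      ⨆ μ : PMF ((Fin n → Bool) × (Fin n → Bool)), (P.infoCost μ : EReal) := by
  refine le_iInf₂ fun P hP => iInf₂_le_of_le (P.comap φ ψ) (hP.comap h) ?_
  exact iSup_le fun μ => le_iSup_of_le (μ.map (Prod.map φ ψ))
    (EReal.coe_le_coe_iff.2 (P.infoCost_comap_le φ ψ μ))

theorem IC_eq_of_reducesVia (h : f.ReducesVia g φ ψ) (h' : g.ReducesVia f φ' ψ') :
    f.IC = g.IC :=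
  congrArg EReal.toReal (le_antisymm (iInf_iSup_infoCost_le h) (iInf_iSup_infoCost_le h'))

/-! ### Encoding an input in a Hamming weight -/

/-- The Hamming weight of a bit string. -/
def weight (x : Fin m → Bool) : ℕ := (Finset.univ.filter fun i => x i = true).card

theorem weight_comp_perm (x : Fin m → Bool) (π : Equiv.Perm (Fin m)) :
    weight (x ∘ π) = weight x :=
  Finset.card_equiv π (by simp)

theorem exists_weight_eq {k : ℕ} (hk : k ≤ m) : ∃ x : Fin m → Bool, weight x = k :=
  ⟨fun i => decide (i.val < k), by simp [weight, Fin.card_filter_val_lt, hk]⟩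

/-- An arbitrary numbering of the bit strings of length `n`. -/
noncomputable def stringEquiv (n : ℕ) : (Fin n → Bool) ≃ Fin (2 ^ n) :=
  Fintype.equivFinOfCardEq (by simp)

/-- The string of length `n` whose number is the weight of `x`, reduced modulo `2 ^ n`. -/
noncomputable def decode (n : ℕ) (x : Fin (2 ^ n) → Bool) : Fin n → Bool :=
  (stringEquiv n).symm (Fin.ofNat (2 ^ n) (weight x))

/-- Every number below `2 ^ n` is a weight of some string of length `2 ^ n`. The one extra weight,
`2 ^ n` itself, wraps around to `0` and is not needed. -/
theorem exists_rightInverse_decode (n : ℕ) :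
    ∃ s : (Fin n → Bool) → (Fin (2 ^ n) → Bool), ∀ x, decode n (s x) = x := by
  choose s hs using fun x => exists_weight_eq (stringEquiv n x).isLt.le
  refine ⟨s, fun x => ?_⟩
  rw [decode, hs, Equiv.symm_apply_eq]
  exact Fin.ofNat_val_eq_self _

/-- The permutation-invariant function that evaluates `g` at the decoded weights. -/
noncomputable def onWeights (g : PartialBoolFun n) : PartialBoolFun (2 ^ n) :=
  fun x y => g (decode n x) (decode n y)

theorem permInvariant_onWeights (g : PartialBoolFun n) : g.onWeights.PermInvariant :=
  fun π x y => by simp only [onWeights, decode, weight_comp_perm]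

theorem onWeights_R_IC (g : PartialBoolFun n) : g.onWeights.R = g.R ∧ g.onWeights.IC = g.IC := by
  obtain ⟨s, hs⟩ := exists_rightInverse_decode n
  have h : g.onWeights.ReducesVia g (decode n) (decode n) := fun _ _ _ hb => hb
  have h' : g.ReducesVia g.onWeights s s := fun x y b hb => by rwa [onWeights, hs, hs]
  exact ⟨R_eq_of_reducesVia h h', IC_eq_of_reducesVia h h'⟩

end PartialBoolFun

theorem mainTheorem11 (G : ℝ → ℝ) (p : Polynomial ℝ)
    (hG : ∀ n : ℕ, 1 ≤ n → ∀ f : PartialBoolFun n, f.PermInvariant →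
      (f.R : ℝ) ≤ p.eval f.IC + G (Real.logb 2 n)) :
    ∀ (n : ℕ) (g : PartialBoolFun n), (g.R : ℝ) ≤ p.eval g.IC + G n := by
  intro n g
  -- The length `2 ^ n` is at least `1` even when `n = 0`, so the hypothesis applies for every `n`.
  have h := hG (2 ^ n) Nat.one_le_two_pow g.onWeights g.permInvariant_onWeights
  have hlog : Real.logb 2 ((2 ^ n : ℕ) : ℝ) = n := by
    rw [Nat.cast_pow, Nat.cast_ofNat, Real.logb_pow, Real.logb_self_eq_one one_lt_two, mul_one]
  rwa [g.onWeights_R_IC.1, g.onWeights_R_IC.2, hlog] at h
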